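/- Let $\theta\in\mathbb R$, let $A',B',K$ be finite-dimensional quantum registers, let $A,B$ be qubits, let $|\psi(\theta)\rangle_{AB}=\cos\theta\,|00\rangle+\sin\theta\,|11\rangle$, and let $|\Omega\rangle_{A'B'K}$ be an arbitrary unit vector. Alice holds $AA'$, Bob holds $BB'$ and the Bank holds $K$. A measurement on $K$ is a finite family of operators $\{M_m\}$ on $K$ with $\sum_m M_m^\dagger M_m=\mathbb I_K$. Outcome $m$ has probability $p_m=\|\widetilde\Psi_m\|^2$, where $|\widetilde\Psi_m\rangle=(\mathbb I_{AA'BB'}\otimes M_m)(|\psi(\theta)\rangle\otimes|\Omega\rangle)$, and, if $p_m>0$, it leaves $AA'BB'$ in the conditional state $\rho_m=\operatorname{tr}_K|\widetilde\Psi_m\rangle\langle\widetilde\Psi_m|/p_m$. *Deterministic Bell-pair restoration in the Bank-measures model is possible* if there are a measurement $\{M_m\}$ on $K$ and LOCC channels $\Lambda_m$ (finitely many rounds of local finite-outcome measurements and classical communication between Alice and Bob, local ancillas and discarding of local subsystems allowed) from $AA'|BB'$ to $A|B$ such that $\Lambda_m(\rho_m)=|\Phi^+\rangle\langle\Phi^+|_{AB}$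 for every $m$ with $p_m>0$, where $|\Phi^+\rangle=(|00\rangle+|11\rangle)/\sqrt2$. Define $$\mu_*(\theta,\Omega)=\inf_{\{M_m\}}\ \max_{m:\,p_m>0}\ \lambda_{\max}(\Psi_m),$$ where the infimum runs over the measurements on $K$ for which every branch with $p_m>0$ leaves $AA'BB'$ in a pure state, $\rho_m=|\Psi_m\rangle\langle\Psi_m|$ (for instance all measurements whose operators $M_m$ have rank one), and $\lambda_{\max}(\Psi_m)$ is the largest squared Schmidt coefficient of $\Psi_m$ across $AA'|BB'$. Then deterministic Bell-pair restoration in the Bank-measures model is possible if and only if $\mu_*(\theta,\Omega)\le \tfrac12$. -/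

import Mathlib

open scoped Kronecker Matrix

noncomputable section

namespace BankAssist

/-- The link state `cos θ |00⟩ + sin θ |11⟩` on the qubits `A`, `B`. -/
def linkState (θ : ℝ) : Fin 2 × Fin 2 → ℂ := fun x =>
  if x = (0, 0) then (Real.cos θ : ℂ) else if x = (1, 1) then (Real.sin θ : ℂ) else 0

/-- The rank-one operator `|φ⟩⟨φ|`. -/
def ketbra {s : Type} (φ : s → ℂ) : Matrix s s ℂ := Matrix.vecMulVec φ (star φ)

/-- The density matrix of the Bell pair `(|00⟩ + |11⟩) / √2` on `A`, `B`. -/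
def bellState : Matrix (Fin 2 × Fin 2) (Fin 2 × Fin 2) ℂ :=
  ketbra fun x => if x.1 = x.2 then ((1 / Real.sqrt 2 : ℝ) : ℂ) else 0

/-- The operators `M m : ℂ^s → ℂ^t` satisfy `∑ m, (M m)† (M m) = 1`, i.e. they are the
operators of a measurement with `n` outcomes. -/
def IsMeasurement {s t : Type} [Fintype s] [DecidableEq s] [Fintype t] {n : ℕ}
    (M : Fin n → Matrix t s ℂ) : Prop :=
  ∑ m, (M m)ᴴ * M m = 1

/-- LOCC channels from operators on `a ⊗ b` (Alice's system `a`, Bob's system `b`) to operators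
on `a' ⊗ b'`: finitely many rounds, in each of which one party performs a local measurement
(whose operators may change the local dimension, so that adding ancillas and
discarding subsystems are included) and announces the outcome, and the rest of the protocol may
depend on that outcome. Not using an outcome is allowed, as the continuations may coincide. -/
inductive IsLOCC {a' b' : Type} [Fintype a'] [DecidableEq a'] [Fintype b'] [DecidableEq b'] :
    ∀ {a b : Type} [Fintype a] [DecidableEq a] [Fintype b] [DecidableEq b],
      (Matrix (a × b) (a × b) ℂ → Matrix (a' × b') (a' × b') ℂ) → Prop
  | done : IsLOCC (fun ρ : Matrix (a' × b') (a' × b') ℂ => ρ)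
  | alice {a b c : Type} [Fintype a] [DecidableEq a] [Fintype b] [DecidableEq b]
      [Fintype c] [DecidableEq c] {n : ℕ} (E : Fin n → Matrix c a ℂ) (hE : IsMeasurement E)
      (Φ : Fin n → Matrix (c × b) (c × b) ℂ → Matrix (a' × b') (a' × b') ℂ)
      (hΦ : ∀ i, IsLOCC (Φ i)) :
      IsLOCC (fun ρ : Matrix (a × b) (a × b) ℂ =>
        ∑ i, Φ i ((E i ⊗ₖ (1 : Matrix b b ℂ)) * ρ * (E i ⊗ₖ (1 : Matrix b b ℂ))ᴴ))
  | bob {a b c : Type} [Fintype a] [DecidableEq a] [Fintype b] [DecidableEq b]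
      [Fintype c] [DecidableEq c] {n : ℕ} (E : Fin n → Matrix c b ℂ) (hE : IsMeasurement E)
      (Φ : Fin n → Matrix (a × c) (a × c) ℂ → Matrix (a' × b') (a' × b') ℂ)
      (hΦ : ∀ i, IsLOCC (Φ i)) :
      IsLOCC (fun ρ : Matrix (a × b) (a × b) ℂ =>
        ∑ i, Φ i (((1 : Matrix a a ℂ) ⊗ₖ E i) * ρ * ((1 : Matrix a a ℂ) ⊗ₖ E i)ᴴ))

/-- The largest squared Schmidt coefficient of a vector `φ ∈ ℂ^a ⊗ ℂ^b` across `a | b`. The squared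
Schmidt coefficients are the eigenvalues of `C C†` (the reduced operator on `a`), where `C` is
the coefficient matrix of `φ`. -/
def maxSchmidtSq {a b : Type} [Fintype a] [DecidableEq a] [Fintype b] (φ : a × b → ℂ) : ℝ :=
  ⨆ i, (Matrix.isHermitian_mul_conjTranspose_self
    (Matrix.of fun (x : a) (y : b) => φ (x, y))).eigenvalues i

section Bank

variable {A' B' K : Type} [Fintype A'] [DecidableEq A'] [Fintype B'] [DecidableEq B']
  [Fintype K] [DecidableEq K]

/-- The joint state `ψ(θ)_{AB} ⊗ Ω_{A'B'K}`, with the registers ordered as `((AA')(BB'))K`. -/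
def jointState (θ : ℝ) (Ω : EuclideanSpace ℂ (A' × B' × K)) :
    ((Fin 2 × A') × (Fin 2 × B')) × K → ℂ :=
  fun x => linkState θ (x.1.1.1, x.1.2.1) * Ω (x.1.1.2, x.1.2.2, x.2)

/-- The unnormalized state `(1_{AA'BB'} ⊗ M) (ψ(θ) ⊗ Ω)` after the Bank's operator `M` on `K`. -/
def branch (θ : ℝ) (Ω : EuclideanSpace ℂ (A' × B' × K)) (M : Matrix K K ℂ) :
    ((Fin 2 × A') × (Fin 2 × B')) × K → ℂ :=
  ((1 : Matrix ((Fin 2 × A') × (Fin 2 × B')) ((Fin 2 × A') × (Fin 2 × B')) ℂ) ⊗ₖ M) *ᵥ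
    jointState θ Ω

/-- The probability of the branch given by `M`. -/
def branchProb (θ : ℝ) (Ω : EuclideanSpace ℂ (A' × B' × K)) (M : Matrix K K ℂ) : ℝ :=
  ∑ x, ‖branch θ Ω M x‖ ^ 2

/-- The normalized conditional state of `AA'BB'` in the branch given by `M`; the Bank's register
`K` is traced out. It is used only when the branch probability is nonzero. -/
def condState (θ : ℝ) (Ω : EuclideanSpace ℂ (A' × B' × K)) (M : Matrix K K ℂ) :
    Matrix ((Fin 2 × A') × (Fin 2 × B')) ((Fin 2 × A') × (Fin 2 × B')) ℂ :=
  ((branchProb θ Ω M)⁻¹ : ℂ) •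
    Matrix.of fun x y => ∑ k, branch θ Ω M (x, k) * star (branch θ Ω M (y, k))

/-- Deterministic Bell-pair restoration in the Bank-measures model: the Bank performs some
finite-outcome measurement on `K` and broadcasts the outcome `m`, and then, for each outcome that
can occur, an LOCC channel `Λ m` of Alice and Bob turns the conditional state of `AA' | BB'` into
the Bell pair on `A | B`. -/
def BankMeasuresFeasible (θ : ℝ) (Ω : EuclideanSpace ℂ (A' × B' × K)) : Prop :=
  ∃ (n : ℕ) (M : Fin n → Matrix K K ℂ), IsMeasurement M ∧
    ∃ Λ : Fin n → Matrix ((Fin 2 × A') × (Fin 2 × B')) ((Fin 2 × A') × (Fin 2 × B')) ℂ →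
        Matrix (Fin 2 × Fin 2) (Fin 2 × Fin 2) ℂ,
      (∀ m, IsLOCC (Λ m)) ∧
      ∀ m, branchProb θ Ω (M m) ≠ 0 → Λ m (condState θ Ω (M m)) = bellState

/-- `Ψ m` is the pure conditional state of `AA'BB'` for each outcome `m` that can occur (unique
up to a phase). Such a `Ψ` exists, for example, when all `M m` have rank one. -/
def IsPureBranches (θ : ℝ) (Ω : EuclideanSpace ℂ (A' × B' × K)) {n : ℕ}
    (M : Fin n → Matrix K K ℂ) (Ψ : Fin n → (Fin 2 × A') × (Fin 2 × B') → ℂ) : Prop :=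
  ∀ m, branchProb θ Ω (M m) ≠ 0 → condState θ Ω (M m) = ketbra (Ψ m)

/-- The minimax quantity: the infimum, over the finite-outcome measurements on `K` that leave
`AA'BB'` in a pure state `Ψ m` in each branch `m`, of the maximum over the branches of nonzero
probability of the largest squared Schmidt coefficient of `Ψ m` across `AA' | BB'`. -/
def muStar (θ : ℝ) (Ω : EuclideanSpace ℂ (A' × B' × K)) : ℝ :=
  sInf {t : ℝ | ∃ (n : ℕ) (M : Fin n → Matrix K K ℂ)
      (Ψ : Fin n → (Fin 2 × A') × (Fin 2 × B') → ℂ),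
    IsMeasurement M ∧ IsPureBranches θ Ω M Ψ ∧
      t = ⨆ m : {m : Fin n // branchProb θ Ω (M m) ≠ 0}, maxSchmidtSq (Ψ m)}

end Bank

end BankAssist

end

/-! The largest squared Schmidt coefficient of a pure state with coefficient matrix `C` is the
squared operator norm of `C` (`maxSchmidtSq_eq`). The core is a criterion for one, possibly
unnormalized, pure state: LOCC turns it into a Bell pair exactly when this quantity is at most half
of the squared norm.

Necessity (`IsLOCC.norm_coeff_sq_le`) is an induction on the protocol: a local measurement preserves
the total squared norm, while the squared operator norms of its branches add up to at least the
original one. Hence the bound, which holds at the Bell pair, propagates back to the input.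
Sufficiency (`exists_isLOCC_bellState`) splits the Schmidt spectrum into weighted pairs of distinct
indices (`exists_pairing`); Alice measures which pair occurs and Bob corrects.

If restoration is possible, reading out `K` completely after the Bank's measurement gives pure
branches. The channels are linear and positive and the Bell pair is pure, so each of these branches
is still sent to a multiple of it, and the criterion bounds `muStar`. Conversely, the infimum is
approached by measurements whose number of outcomes is not bounded, so limits cannot be taken
directly. `exists_isResolution_le_zero` replaces this by convexity: the normalized identity lies in
the convex hull of the compact set of admissible rank-one projectors, which yields an exact optimal
measurement. -/

noncomputable section

namespace BankAssist

/-! ### Convex geometry: compact hulls and pairing of weights -/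

/-- In finite dimension the convex hull of a compact set is compact. -/
theorem isCompact_convexHull_of_finiteDimensional {E : Type*} [NormedAddCommGroup E]
    [NormedSpace ℝ E] [FiniteDimensional ℝ E] {s : Set E} (hs : IsCompact s) :
    IsCompact (convexHull ℝ s) := by
  classical
  rcases s.eq_empty_or_nonempty with rfl | ⟨x₀, hx₀⟩
  · simp
  let d := Module.finrank ℝ E + 1
  let F : (Fin d → ℝ) × (Fin d → E) → E := fun p => ∑ i, p.1 i • p.2 i
  have hF : Continuous F := by fun_prop
  have hc : IsCompact (stdSimplex ℝ (Fin d) ×ˢ Set.pi Set.univ fun _ : Fin d => s) :=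
    (isCompact_stdSimplex ℝ _).prod (isCompact_univ_pi fun _ => hs)
  suffices h : convexHull ℝ s = F '' (stdSimplex ℝ (Fin d) ×ˢ Set.pi Set.univ fun _ => s) by
    rw [h]; exact hc.image hF
  refine Set.Subset.antisymm (fun x hx => ?_) ?_
  · obtain ⟨ι, _, z, w, hz, hind, hw, hw1, hx⟩ := eq_pos_convex_span_of_mem_convexHull hx
    have hcard : Fintype.card ι ≤ Fintype.card (Fin d) := by
      rw [Fintype.card_fin]; exact hind.card_le_finrank_succ.trans
        (Nat.succ_le_succ (Submodule.finrank_le _))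
    obtain ⟨e⟩ := Function.Embedding.nonempty_of_card_le hcard
    -- Carathéodory bounds the number of points; unused slots get weight zero and the dummy point
    -- `x₀`.
    refine ⟨(Function.extend e w 0, Function.extend e z fun _ => x₀), ⟨⟨fun j => ?_, ?_⟩, ?_⟩, ?_⟩
    · by_cases h : ∃ i, e i = j
      · obtain ⟨i, rfl⟩ := h
        simpa [e.injective.extend_apply] using (hw i).le
      · simp [Function.extend_apply' _ _ _ h]
    · rw [← hw1]
      refine (Fintype.sum_of_injective e e.injective _ _ (fun j hj => ?_) fun i => ?_).symm
      · exact Function.extend_apply' _ _ _ hj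
      · simp [e.injective.extend_apply]
    · intro j _
      by_cases h : ∃ i, e i = j
      · obtain ⟨i, rfl⟩ := h
        simpa [e.injective.extend_apply] using hz ⟨i, rfl⟩
      · simpa [Function.extend_apply' _ _ _ h] using hx₀
    · rw [← hx]
      refine (Fintype.sum_of_injective e e.injective _ _ (fun j hj => ?_) fun i => ?_).symm
      · have : Function.extend e w 0 j = 0 := Function.extend_apply' _ _ _ hj
        simp [this]
      · simp [e.injective.extend_apply]
  · rintro _ ⟨⟨w, z⟩, ⟨⟨hw, hw1⟩, hz⟩, rfl⟩
    exact mem_convexHull_of_exists_fintype w z hw hw1 (fun i => hz i trivial) rfl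

/-- A nonnegative vector none of whose entries exceeds half of their sum is a nonnegative
combination of vectors `e_p + e_q` with `p ≠ q`. -/
theorem exists_pairing {ι : Type} [Fintype ι] [DecidableEq ι] (l : ι → ℝ) (h0 : ∀ k, 0 ≤ l k)
    (hl : ∀ k, l k ≤ (∑ j, l j) / 2) :
    ∃ (κ : Type) (_ : Fintype κ) (w : κ → ℝ) (p q : κ → ι), (∀ i, 0 ≤ w i) ∧
      (∀ i, p i ≠ q i) ∧
      ∀ k, l k = ∑ i, w i * ((if p i = k then 1 else 0) + (if q i = k then 1 else 0)) := by
  rcases (Finset.sum_nonneg fun j _ => h0 j : 0 ≤ ∑ j, l j).eq_or_lt with hS | hS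
  · refine ⟨Empty, inferInstance, fun _ => 0, Empty.elim, Empty.elim, by simp, by simp, fun k => ?_⟩
    have := hl k
    have := h0 k
    simp only [Finset.univ_eq_empty, Finset.sum_empty]
    linarith
  set S := ∑ j, l j with hSdef
  let v : {p : ι × ι // p.1 ≠ p.2} → ι → ℝ := fun p => Pi.single p.1.1 1 + Pi.single p.1.2 1
  -- The factor `2 / S` makes the coordinates sum to 2, as they do for every `e_p + e_q`.
  have hmem : (2 / S) • l ∈ convexHull ℝ (Set.range v) := by
    by_contra hx
    obtain ⟨f, u, hf, hfx⟩ := geometric_hahn_banach_closed_point (convex_convexHull ℝ _)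
      ((Set.finite_range v).isClosed_convexHull ℝ) hx
    let y : ι → ℝ := fun k => f (Pi.single k 1)
    have hy : ∀ k j, k ≠ j → y k + y j < u := fun k j hkj => by
      have := hf (v ⟨(k, j), hkj⟩) (subset_convexHull ℝ _ ⟨_, rfl⟩)
      simpa [v, y] using this
    have hfl : f l = ∑ k, l k * y k := by
      conv_lhs => rw [pi_eq_sum_univ' l]
      simp [y, map_sum]
    have hne : (Finset.univ : Finset ι).Nonempty := by
      by_contra h
      rw [Finset.not_nonempty_iff_eq_empty] at h
      simp [hSdef, h] at hS
    obtain ⟨k₀, -, hk₀⟩ := Finset.exists_max_image Finset.univ y hne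
    -- Only the largest `y k₀` can exceed `u / 2`. If it does, the other `y k` are at most `u - y
    -- k₀`, and the sum exceeds `S * u / 2` by at most `(2 * l k₀ - S) * (y k₀ - u / 2)`, which is
    -- nonpositive by `hl`.
    have hsum : ∑ k, l k * y k ≤ S * (u / 2) := by
      have h1 : ∀ k ∈ Finset.univ.erase k₀, l k * y k ≤ l k * (u - y k₀) := fun k hk =>
        mul_le_mul_of_nonneg_left (by have := hy k k₀ (Finset.ne_of_mem_erase hk); linarith) (h0 k)
      have h2 := Finset.sum_le_sum h1
      rw [← Finset.sum_mul] at h2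
      have h3 := Finset.add_sum_erase Finset.univ (fun k => l k * y k) (Finset.mem_univ k₀)
      have h4 := Finset.add_sum_erase Finset.univ l (Finset.mem_univ k₀)
      have h5 := hl k₀
      have h6 : u / 2 ≤ y k₀ ∨ y k₀ ≤ u / 2 := le_total _ _
      rw [← hSdef] at h4
      rcases h6 with h6 | h6
      · have h7 : ∑ k ∈ Finset.univ.erase k₀, l k = S - l k₀ := by linarith
        rw [h7] at h2
        nlinarith [mul_nonneg (sub_nonneg.2 h5) (sub_nonneg.2 h6)]
      · calc ∑ k, l k * y k ≤ ∑ k, l k * (u / 2) := Finset.sum_le_sum fun k _ =>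
              mul_le_mul_of_nonneg_left ((hk₀ k (Finset.mem_univ k)).trans h6) (h0 k)
          _ = S * (u / 2) := by rw [Finset.sum_mul]
    rw [map_smul, hfl, smul_eq_mul] at hfx
    have : 2 / S * ∑ k, l k * y k ≤ 2 / S * (S * (u / 2)) :=
      mul_le_mul_of_nonneg_left hsum (by positivity)
    have h7 : 2 / S * (S * (u / 2)) = u := by field_simp
    linarith
  obtain ⟨κ, _, w, z, hw, -, hz, hx⟩ := mem_convexHull_iff_exists_fintype.1 hmem
  choose r hr using hz
  refine ⟨κ, inferInstance, fun i => S / 2 * w i, fun i => (r i).1.1, fun i => (r i).1.2,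
    fun i => mul_nonneg (by positivity) (hw i), fun i => (r i).2, fun k => ?_⟩
  have := congrFun hx k
  simp only [Finset.sum_apply, Pi.smul_apply, smul_eq_mul, ← hr, v, Pi.add_apply,
    Pi.single_apply] at this
  have h8 : l k = S / 2 * (2 / S * l k) := by field_simp
  rw [h8, ← this, Finset.mul_sum]
  refine Finset.sum_congr rfl fun i _ => ?_
  simp only [eq_comm (a := k), mul_assoc]

/-! ### Squared norms, rank-one operators and coefficient matrices -/

open scoped Matrix.Norms.L2Operator ComplexOrder

/-- The squared norm of a vector. -/
def normSq {s : Type} [Fintype s] (φ : s → ℂ) : ℝ := ∑ x, ‖φ x‖ ^ 2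

theorem normSq_nonneg {s : Type} [Fintype s] (φ : s → ℂ) : 0 ≤ normSq φ :=
  Finset.sum_nonneg fun _ _ => by positivity

theorem ofReal_normSq {s : Type} [Fintype s] (φ : s → ℂ) :
    ((normSq φ : ℝ) : ℂ) = star φ ⬝ᵥ φ := by
  simp [normSq, dotProduct, Complex.conj_mul']

theorem normSq_smul {s : Type} [Fintype s] (c : ℂ) (φ : s → ℂ) :
    normSq (c • φ) = ‖c‖ ^ 2 * normSq φ := by
  simp [normSq, mul_pow, Finset.mul_sum]

theorem normSq_eq_zero {s : Type} [Fintype s] {φ : s → ℂ} (h : normSq φ = 0) : φ = 0 := by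
  funext x
  have := (Finset.sum_eq_zero_iff_of_nonneg fun x _ => by positivity).1 h x (Finset.mem_univ x)
  simpa using this

theorem ketbra_smul {s : Type} (c : ℂ) (φ : s → ℂ) :
    ketbra (c • φ) = ((‖c‖ ^ 2 : ℝ) : ℂ) • ketbra φ := by
  ext i j
  simp only [ketbra, Matrix.vecMulVec_apply, Pi.smul_apply, Pi.star_apply, smul_eq_mul, star_mul',
    Matrix.smul_apply, Complex.ofReal_pow, ← Complex.mul_conj']
  simp only [RCLike.star_def]
  ring

theorem conj_ketbra {s t : Type} [Fintype s] (A : Matrix t s ℂ) (φ : s → ℂ) :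
    A * ketbra φ * Aᴴ = ketbra (A *ᵥ φ) := by
  rw [ketbra, ketbra, Matrix.mul_vecMulVec, Matrix.vecMulVec_mul, Matrix.star_mulVec]

theorem posSemidef_ketbra {s : Type} [Fintype s] (φ : s → ℂ) : (ketbra φ).PosSemidef :=
  Matrix.posSemidef_vecMulVec_self_star φ

/-- A measurement preserves the total squared norm. -/
theorem sum_normSq_mulVec {ι s t : Type} [Fintype ι] [Fintype s] [DecidableEq s] [Fintype t]
    {M : ι → Matrix t s ℂ} (hM : ∑ i, (M i)ᴴ * M i = 1) (φ : s → ℂ) :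
    ∑ i, normSq (M i *ᵥ φ) = normSq φ := by
  have : ((∑ i, normSq (M i *ᵥ φ) : ℝ) : ℂ) = (normSq φ : ℝ) := by
    simp only [Complex.ofReal_sum, ofReal_normSq]
    calc ∑ i, star (M i *ᵥ φ) ⬝ᵥ (M i *ᵥ φ) = ∑ i, star φ ⬝ᵥ (((M i)ᴴ * M i) *ᵥ φ) := by
          refine Finset.sum_congr rfl fun i _ => ?_
          rw [Matrix.star_mulVec, ← Matrix.dotProduct_mulVec, Matrix.mulVec_mulVec]
      _ = star φ ⬝ᵥ φ := by
          rw [← dotProduct_sum, ← Matrix.sum_mulVec, hM, Matrix.one_mulVec]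
  exact_mod_cast this

section Kronecker

variable {ι a b c : Type} [Fintype ι]

theorem sum_kronecker_one [DecidableEq a] [Fintype b] [DecidableEq b] [Fintype c]
    {E : ι → Matrix c a ℂ} (hE : ∑ i, (E i)ᴴ * E i = 1) :
    ∑ i, (E i ⊗ₖ (1 : Matrix b b ℂ))ᴴ * (E i ⊗ₖ (1 : Matrix b b ℂ)) = 1 := by
  simp only [Matrix.conjTranspose_kronecker, ← Matrix.mul_kronecker_mul, Matrix.conjTranspose_one,
    Matrix.mul_one]
  ext x y
  have := congrFun (congrFun hE x.1) y.1
  rw [Matrix.sum_apply] at this ⊢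
  simp only [Matrix.kroneckerMap_apply, ← Finset.sum_mul]
  rw [this, ← Matrix.kroneckerMap_apply (· * ·) (1 : Matrix a a ℂ) (1 : Matrix b b ℂ),
    Matrix.one_kronecker_one]

theorem sum_one_kronecker [Fintype a] [DecidableEq a] [DecidableEq b] [Fintype c]
    {E : ι → Matrix c b ℂ} (hE : ∑ i, (E i)ᴴ * E i = 1) :
    ∑ i, ((1 : Matrix a a ℂ) ⊗ₖ E i)ᴴ * ((1 : Matrix a a ℂ) ⊗ₖ E i) = 1 := by
  simp only [Matrix.conjTranspose_kronecker, ← Matrix.mul_kronecker_mul, Matrix.conjTranspose_one,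
    Matrix.mul_one]
  ext x y
  have := congrFun (congrFun hE x.2) y.2
  rw [Matrix.sum_apply] at this ⊢
  simp only [Matrix.kroneckerMap_apply, ← Finset.mul_sum]
  rw [this, ← Matrix.kroneckerMap_apply (· * ·) (1 : Matrix a a ℂ) (1 : Matrix b b ℂ),
    Matrix.one_kronecker_one]

/-- The coefficient matrix of a bipartite vector. -/
def coeff {a b : Type} (φ : a × b → ℂ) : Matrix a b ℂ := Matrix.of fun x y => φ (x, y)

theorem coeff_kronecker_one_mulVec [Fintype a] [Fintype b] [DecidableEq b] (E : Matrix c a ℂ)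
    (φ : a × b → ℂ) :
    coeff ((E ⊗ₖ (1 : Matrix b b ℂ)) *ᵥ φ) = E * coeff φ := by
  ext x y
  simp [coeff, Matrix.mulVec, dotProduct, Matrix.mul_apply, Fintype.sum_prod_type,
    Matrix.one_apply]

theorem coeff_one_kronecker_mulVec [Fintype a] [DecidableEq a] [Fintype b] (E : Matrix c b ℂ)
    (φ : a × b → ℂ) :
    coeff (((1 : Matrix a a ℂ) ⊗ₖ E) *ᵥ φ) = coeff φ * Eᵀ := by
  ext x y
  simp only [coeff, Matrix.mulVec, dotProduct, Matrix.mul_apply, Fintype.sum_prod_type,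
    Matrix.one_apply, Matrix.kroneckerMap_apply, Matrix.of_apply, Matrix.transpose_apply]
  rw [Finset.sum_eq_single x (fun z _ hz => by simp [hz.symm]) (by simp)]
  simp [mul_comm]

theorem normSq_eq_trace_coeff [Fintype a] [Fintype b] (φ : a × b → ℂ) :
    ((normSq φ : ℝ) : ℂ) = (coeff φ * (coeff φ)ᴴ).trace := by
  simp [normSq, Matrix.trace, Matrix.mul_apply, coeff, Fintype.sum_prod_type, Complex.mul_conj']

end Kronecker

/-! ### Operator norms under local measurements -/

section OpNorm

variable {ι a b c : Type} [Fintype ι] [Fintype a] [DecidableEq a] [Fintype b] [DecidableEq b]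
  [Fintype c]

/-- Completeness gives `C†C = ∑ (E i C)†(E i C)`; the C*-identity and the triangle inequality
finish. -/
theorem norm_sq_le_sum_left {E : ι → Matrix c a ℂ} (hE : ∑ i, (E i)ᴴ * E i = 1)
    (C : Matrix a b ℂ) : ‖C‖ ^ 2 ≤ ∑ i, ‖E i * C‖ ^ 2 := by
  have : Cᴴ * C = ∑ i, (E i * C)ᴴ * (E i * C) := by
    calc Cᴴ * C = Cᴴ * (∑ i, (E i)ᴴ * E i) * C := by rw [hE, Matrix.mul_one]
      _ = _ := by simp only [Matrix.conjTranspose_mul, Matrix.mul_sum, Matrix.sum_mul,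
                    Matrix.mul_assoc]
  rw [sq, ← Matrix.l2_opNorm_conjTranspose_mul_self, this]
  refine (norm_sum_le _ _).trans (Finset.sum_le_sum fun i _ => ?_)
  rw [Matrix.l2_opNorm_conjTranspose_mul_self, sq]

/-- The mirror argument with `CC†`: Bob's operators act on `C` from the right through their
transposes, so completeness is transposed first. -/
theorem norm_sq_le_sum_right [DecidableEq c] {E : ι → Matrix c b ℂ}
    (hE : ∑ i, (E i)ᴴ * E i = 1)
    (C : Matrix a b ℂ) : ‖C‖ ^ 2 ≤ ∑ i, ‖C * (E i)ᵀ‖ ^ 2 := by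
  have hE' : ∑ i, (E i)ᵀ * (E i)ᵀᴴ = 1 := by
    have := congrArg Matrix.transpose hE
    simpa [Matrix.transpose_sum, Matrix.transpose_mul, Matrix.conjTranspose, Matrix.transpose_map]
      using this
  have : C * Cᴴ = ∑ i, (C * (E i)ᵀ) * (C * (E i)ᵀ)ᴴ := by
    calc C * Cᴴ = C * (∑ i, (E i)ᵀ * (E i)ᵀᴴ) * Cᴴ := by rw [hE', Matrix.mul_one]
      _ = _ := by simp only [Matrix.conjTranspose_mul, Matrix.mul_sum, Matrix.sum_mul,
                    Matrix.mul_assoc]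
  have key : ∀ {d : Type} [Fintype d] [DecidableEq d] (X : Matrix a d ℂ),
      ‖X * Xᴴ‖ = ‖X‖ ^ 2 := fun X => by
    rw [sq, ← Matrix.l2_opNorm_conjTranspose X, ← Matrix.l2_opNorm_conjTranspose_mul_self,
      Matrix.conjTranspose_conjTranspose]
  rw [← key, this]
  exact (norm_sum_le _ _).trans (Finset.sum_le_sum fun i _ => (key _).le)

end OpNorm

/-! ### Structure of LOCC channels -/

section LOCC

variable {a' b' : Type} [Fintype a'] [DecidableEq a'] [Fintype b'] [DecidableEq b']

theorem IsLOCC.alice_fintype {a b c : Type} [Fintype a] [DecidableEq a] [Fintype b]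
    [DecidableEq b] [Fintype c] [DecidableEq c] {ι : Type} [Fintype ι] (E : ι → Matrix c a ℂ)
    (hE : ∑ i, (E i)ᴴ * E i = 1)
    (Φ : ι → Matrix (c × b) (c × b) ℂ → Matrix (a' × b') (a' × b') ℂ) (hΦ : ∀ i, IsLOCC (Φ i)) :
    IsLOCC (fun ρ : Matrix (a × b) (a × b) ℂ =>
      ∑ i, Φ i ((E i ⊗ₖ (1 : Matrix b b ℂ)) * ρ * (E i ⊗ₖ (1 : Matrix b b ℂ))ᴴ)) := by
  let e := (Fintype.equivFin ι).symm
  have h := IsLOCC.alice (b := b) (fun j => E (e j))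
    ((Equiv.sum_comp e fun i => (E i)ᴴ * E i).trans hE) (fun j => Φ (e j)) fun j => hΦ (e j)
  convert h using 2 with ρ
  exact (Equiv.sum_comp e fun i =>
    Φ i ((E i ⊗ₖ (1 : Matrix b b ℂ)) * ρ * (E i ⊗ₖ (1 : Matrix b b ℂ))ᴴ)).symm

theorem IsLOCC.bob_fintype {a b c : Type} [Fintype a] [DecidableEq a] [Fintype b]
    [DecidableEq b] [Fintype c] [DecidableEq c] {ι : Type} [Fintype ι] (E : ι → Matrix c b ℂ)
    (hE : ∑ i, (E i)ᴴ * E i = 1)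
    (Φ : ι → Matrix (a × c) (a × c) ℂ → Matrix (a' × b') (a' × b') ℂ) (hΦ : ∀ i, IsLOCC (Φ i)) :
    IsLOCC (fun ρ : Matrix (a × b) (a × b) ℂ =>
      ∑ i, Φ i (((1 : Matrix a a ℂ) ⊗ₖ E i) * ρ * ((1 : Matrix a a ℂ) ⊗ₖ E i)ᴴ)) := by
  let e := (Fintype.equivFin ι).symm
  have h := IsLOCC.bob (a := a) (fun j => E (e j))
    ((Equiv.sum_comp e fun i => (E i)ᴴ * E i).trans hE) (fun j => Φ (e j)) fun j => hΦ (e j)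
  convert h using 2 with ρ
  exact (Equiv.sum_comp e fun i =>
    Φ i (((1 : Matrix a a ℂ) ⊗ₖ E i) * ρ * ((1 : Matrix a a ℂ) ⊗ₖ E i)ᴴ)).symm

/-- Linearity lets a channel be distributed over the pure components of a mixture and the
normalization be pulled out. -/
theorem IsLOCC.isLinearMap {a b : Type} [Fintype a] [DecidableEq a] [Fintype b] [DecidableEq b]
    {Λ : Matrix (a × b) (a × b) ℂ → Matrix (a' × b') (a' × b') ℂ} (h : IsLOCC Λ) :
    IsLinearMap ℂ Λ := by
  induction h with
  | done => exact ⟨fun _ _ => rfl, fun _ _ => rfl⟩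
  | alice E hE Φ hΦ ih =>
    exact ⟨fun x y => by
      simp only [Matrix.mul_add, Matrix.add_mul, (ih _).map_add, Finset.sum_add_distrib],
      fun c x => by
      simp only [Matrix.mul_smul, Matrix.smul_mul, (ih _).map_smul, Finset.smul_sum]⟩
  | bob E hE Φ hΦ ih =>
    exact ⟨fun x y => by
      simp only [Matrix.mul_add, Matrix.add_mul, (ih _).map_add, Finset.sum_add_distrib],
      fun c x => by
      simp only [Matrix.mul_smul, Matrix.smul_mul, (ih _).map_smul, Finset.smul_sum]⟩

theorem IsLOCC.posSemidef {a b : Type} [Fintype a] [DecidableEq a] [Fintype b] [DecidableEq b]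
    {Λ : Matrix (a × b) (a × b) ℂ → Matrix (a' × b') (a' × b') ℂ} (h : IsLOCC Λ) :
    ∀ {ρ : Matrix (a × b) (a × b) ℂ}, ρ.PosSemidef → (Λ ρ).PosSemidef := by
  induction h with
  | done => exact fun h => h
  | alice E hE Φ hΦ ih =>
    exact fun h => Matrix.posSemidef_sum _ fun i _ => ih i (h.mul_mul_conjTranspose_same _)
  | bob E hE Φ hΦ ih =>
    exact fun h => Matrix.posSemidef_sum _ fun i _ => ih i (h.mul_mul_conjTranspose_same _)

end LOCC

/-! ### Necessity of the Schmidt bound -/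

/-- A functional vanishing on the Bell pair, and on no other positive operator of trace one. -/
def bellDefect (X : Matrix (Fin 2 × Fin 2) (Fin 2 × Fin 2) ℂ) : ℝ :=
  (X (0, 1) (0, 1) + X (1, 0) (1, 0) +
    (X (0, 0) (0, 0) + X (1, 1) (1, 1) - X (0, 0) (1, 1) - X (1, 1) (0, 0))).re

/-- The functional adds the quadratic forms at `|01⟩`, `|10⟩` and `|00⟩ - |11⟩`, which span the
orthogonal complement of the Bell vector. -/
theorem bellDefect_nonneg {X : Matrix (Fin 2 × Fin 2) (Fin 2 × Fin 2) ℂ} (hX : X.PosSemidef) :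
    0 ≤ bellDefect X := by
  have h := hX.re_dotProduct_nonneg
    fun i => if i = (0, 0) then (1 : ℂ) else if i = (1, 1) then -1 else 0
  have h1 := Complex.nonneg_iff.1 (hX.diag_nonneg (i := (0, 1)))
  have h2 := Complex.nonneg_iff.1 (hX.diag_nonneg (i := (1, 0)))
  simp [Matrix.mulVec, dotProduct, Fintype.sum_prod_type, Fin.sum_univ_two] at h
  simp only [bellDefect, Complex.add_re, Complex.sub_re]
  linarith [h1.1, h2.1]

theorem bellDefect_sum {ι : Type} (s : Finset ι)
    (X : ι → Matrix (Fin 2 × Fin 2) (Fin 2 × Fin 2) ℂ) :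
    bellDefect (∑ i ∈ s, X i) = ∑ i ∈ s, bellDefect (X i) := by
  simp only [bellDefect, Matrix.sum_apply, ← Finset.sum_add_distrib, ← Finset.sum_sub_distrib,
    Complex.re_sum]

theorem bellDefect_smul_bellState (c : ℂ) : bellDefect (c • bellState) = 0 := by
  simp [bellDefect, bellState, ketbra, Matrix.vecMulVec_apply]

/-- If an LOCC channel turns a pure state into a Bell pair, then no squared Schmidt coefficient of
the state exceeds one half. -/
theorem IsLOCC.norm_coeff_sq_le {a b : Type} [Fintype a] [DecidableEq a] [Fintype b]
    [DecidableEq b] {Λ : Matrix (a × b) (a × b) ℂ → Matrix (Fin 2 × Fin 2) (Fin 2 × Fin 2) ℂ}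
    (h : IsLOCC Λ) : ∀ φ : a × b → ℂ, bellDefect (Λ (ketbra φ)) = 0 →
      ‖coeff φ‖ ^ 2 ≤ normSq φ / 2 := by
  induction h with
  | done =>
    intro φ h
    have h' : ‖φ (0, 1)‖ ^ 2 + ‖φ (1, 0)‖ ^ 2 + ‖φ (0, 0) - φ (1, 1)‖ ^ 2 = 0 := by
      rw [← h]
      simp only [bellDefect, ketbra, Matrix.vecMulVec_apply, Pi.star_apply, RCLike.star_def,
        ← Complex.normSq_eq_norm_sq, Complex.normSq_apply, Complex.add_re, Complex.sub_re,
        Complex.mul_re, Complex.conj_re, Complex.conj_im, Complex.sub_im]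
      ring
    have hs1 := sq_nonneg ‖φ (0, 1)‖
    have hs2 := sq_nonneg ‖φ (1, 0)‖
    have hs3 := sq_nonneg ‖φ (0, 0) - φ (1, 1)‖
    have h1 : φ (0, 1) = 0 := by
      rw [← norm_eq_zero, ← sq_eq_zero_iff]
      linarith
    have h2 : φ (1, 0) = 0 := by
      rw [← norm_eq_zero, ← sq_eq_zero_iff]
      linarith
    have h3 : φ (1, 1) = φ (0, 0) := by
      rw [eq_comm, ← sub_eq_zero, ← norm_eq_zero, ← sq_eq_zero_iff]
      linarith
    have h4 : coeff φ = Matrix.diagonal fun _ => φ (0, 0) := by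
      ext i j
      fin_cases i <;> fin_cases j <;> simp [coeff, h1, h2, h3]
    have h5 : normSq φ = 2 * ‖φ (0, 0)‖ ^ 2 := by
      simp [normSq, Fintype.sum_prod_type, Fin.sum_univ_two, h1, h2, h3]
      ring
    rw [h4, h5, Matrix.l2_opNorm_diagonal, pi_norm_const]
    linarith
  | alice E hE Φ hΦ ih =>
    intro φ h
    simp only [conj_ketbra] at h
    -- Nonnegative defects with sum zero vanish separately, so the induction hypothesis applies to
    -- every outcome.
    rw [bellDefect_sum, Finset.sum_eq_zero_iff_of_nonneg fun i _ =>
      bellDefect_nonneg ((hΦ i).posSemidef (posSemidef_ketbra _))] at h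
    refine (norm_sq_le_sum_left hE (coeff φ)).trans ?_
    rw [← sum_normSq_mulVec (sum_kronecker_one hE) φ, Finset.sum_div]
    refine Finset.sum_le_sum fun i hi => ?_
    rw [← coeff_kronecker_one_mulVec]
    exact ih i _ (h i hi)
  | bob E hE Φ hΦ ih =>
    intro φ h
    simp only [conj_ketbra] at h
    rw [bellDefect_sum, Finset.sum_eq_zero_iff_of_nonneg fun i _ =>
      bellDefect_nonneg ((hΦ i).posSemidef (posSemidef_ketbra _))] at h
    refine (norm_sq_le_sum_right hE (coeff φ)).trans ?_
    rw [← sum_normSq_mulVec (sum_one_kronecker hE) φ, Finset.sum_div]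
    refine Finset.sum_le_sum fun i hi => ?_
    rw [← coeff_one_kronecker_mulVec]
    exact ih i _ (h i hi)

/-! ### Sufficiency: the restoration protocol -/

theorem coeff_injective {a b : Type} {φ ψ : a × b → ℂ} (h : coeff φ = coeff ψ) : φ = ψ :=
  funext fun x => congrFun (congrFun h x.1) x.2

theorem ketbra_of_coeff_eq_smul_one {φ : Fin 2 × Fin 2 → ℂ} {r : ℝ} (hr : 0 ≤ r)
    (h : coeff φ = ((Real.sqrt r : ℝ) : ℂ) • (1 : Matrix (Fin 2) (Fin 2) ℂ)) :
    ketbra φ = ((2 * r : ℝ) : ℂ) • bellState := by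
  have hφ : φ = ((Real.sqrt (2 * r) : ℝ) : ℂ) •
      fun x : Fin 2 × Fin 2 => if x.1 = x.2 then ((1 / Real.sqrt 2 : ℝ) : ℂ) else 0 := by
    refine coeff_injective (h.trans ?_)
    ext i j
    have h2 : (Real.sqrt 2 : ℂ) ≠ 0 := by simp
    by_cases hij : i = j
    · simp [coeff, hij, mul_comm, h2]
    · simp [coeff, hij]
  rw [hφ, ketbra_smul, Complex.norm_real, Real.norm_eq_abs, sq_abs, Real.sq_sqrt (by positivity)]
  rfl

/-- Bob alone can turn a pure state that is maximally entangled with Alice's qubit into a Bell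
pair. -/
theorem exists_isLOCC_of_coeff_mul_conjTranspose {b : Type} [Fintype b] [DecidableEq b]
    (φ : Fin 2 × b → ℂ) {r : ℝ} (hr : 0 ≤ r)
    (h : coeff φ * (coeff φ)ᴴ = (r : ℂ) • (1 : Matrix (Fin 2) (Fin 2) ℂ)) :
    ∃ Λ : Matrix (Fin 2 × b) (Fin 2 × b) ℂ → Matrix (Fin 2 × Fin 2) (Fin 2 × Fin 2) ℂ,
      IsLOCC Λ ∧ Λ (ketbra φ) = ((2 * r : ℝ) : ℂ) • bellState := by
  set W := coeff φ with hW
  -- The orthogonal projection onto the range of `Wᴴ`; for `r = 0` both `W` and `P` vanish.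
  set P : Matrix b b ℂ := ((r⁻¹ : ℝ) : ℂ) • (Wᴴ * W) with hP
  have hWP : W * P = W := by
    rcases hr.eq_or_lt with rfl | hr
    · have : W = 0 := by simpa using h
      simp [this]
    · rw [hP, Matrix.mul_smul, ← Matrix.mul_assoc, h, Matrix.smul_mul, Matrix.one_mul, smul_smul,
        ← Complex.ofReal_mul, inv_mul_cancel₀ hr.ne', Complex.ofReal_one, one_smul]
  have hPP : P * P = P := by
    conv_lhs => rw [hP, Matrix.smul_mul, Matrix.mul_assoc, hWP]
  have hPh : Pᴴ = P := by
    simp [hP, Matrix.conjTranspose_smul, Matrix.conjTranspose_mul]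
  -- Transposed Kraus operators for Bob. The outcome `none` sends `W` to `√r` times the identity;
  -- the others live on the complement of `P`, satisfy `W * G = 0`, and only complete the
  -- measurement.
  let G : Option b → Matrix b (Fin 2) ℂ := fun o => o.elim
    (((Real.sqrt r)⁻¹ : ℝ) • Wᴴ) fun j => (1 - P) * Matrix.single j (0 : Fin 2) (1 : ℂ)
  have hG : ∑ o, G o * (G o)ᴴ = 1 := by
    have h1 : (Real.sqrt r)⁻¹ * (Real.sqrt r)⁻¹ = r⁻¹ := by
      rw [← mul_inv, Real.mul_self_sqrt hr]
    have h2 : ∑ j : b, Matrix.single j j (1 : ℂ) = 1 := by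
      ext x y
      simp [Matrix.sum_apply, Matrix.single_apply, Matrix.one_apply, ite_and]
    have h3 : (1 - P) * (1 - P) = 1 - P := by
      rw [Matrix.mul_sub, Matrix.sub_mul, Matrix.sub_mul, hPP]; simp
    rw [Fintype.sum_option]
    have h4 : ∀ j, G (some j) * (G (some j))ᴴ = (1 - P) * Matrix.single j j 1 * (1 - P) := by
      intro j
      simp only [G, Option.elim, Matrix.conjTranspose_mul, Matrix.conjTranspose_sub, hPh,
        Matrix.conjTranspose_one, Matrix.conjTranspose_single, star_one]
      rw [Matrix.mul_assoc, ← Matrix.mul_assoc (Matrix.single j (0 : Fin 2) (1 : ℂ)),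
        Matrix.single_mul_single_same, mul_one, Matrix.mul_assoc]
    simp only [h4]
    rw [← Matrix.sum_mul, ← Matrix.mul_sum, h2, Matrix.mul_one, h3]
    simp only [G, Option.elim, Matrix.conjTranspose_smul, Matrix.smul_mul, Matrix.mul_smul,
      smul_smul, Matrix.conjTranspose_conjTranspose, star_trivial, h1]
    rw [hP]
    ext x y
    simp
  have hF : ∑ o, ((G o)ᵀ)ᴴ * (G o)ᵀ = 1 := by
    have := congrArg Matrix.transpose hG
    simpa [Matrix.transpose_sum, Matrix.transpose_mul, Matrix.conjTranspose, Matrix.transpose_map]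
      using this
  refine ⟨_, IsLOCC.bob_fintype (fun o => (G o)ᵀ) hF (fun _ ρ => ρ) fun _ => IsLOCC.done, ?_⟩
  simp only [conj_ketbra]
  rw [Fintype.sum_option, ketbra_of_coeff_eq_smul_one hr, Finset.sum_eq_zero, add_zero]
  · intro j _
    have : ((1 : Matrix (Fin 2) (Fin 2) ℂ) ⊗ₖ (G (some j))ᵀ) *ᵥ φ = 0 := by
      apply coeff_injective
      rw [coeff_one_kronecker_mulVec, Matrix.transpose_transpose, ← hW]
      simp only [G, Option.elim]
      rw [← Matrix.mul_assoc, Matrix.mul_sub, hWP, Matrix.mul_one, sub_self, Matrix.zero_mul]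
      rfl
    rw [this]
    simp [ketbra]
  · rw [coeff_one_kronecker_mulVec, Matrix.transpose_transpose, ← hW]
    simp only [G, Option.elim, Matrix.mul_smul, h]
    have h5 : (Real.sqrt r)⁻¹ * r = Real.sqrt r := by
      rcases hr.eq_or_lt with rfl | hr
      · simp
      · have := Real.mul_self_sqrt hr.le
        field_simp
        nlinarith
    rw [← Complex.coe_smul, smul_smul, ← Complex.ofReal_mul, h5]

/-- A pure state with diagonal reduced operator, none of whose eigenvalues exceeds half of their
sum, can be turned into a Bell pair. -/
theorem exists_isLOCC_of_diagonal {a b : Type} [Fintype a] [DecidableEq a] [Fintype b]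
    [DecidableEq b] (φ : a × b → ℂ) (l : a → ℝ) (h0 : ∀ k, 0 ≤ l k)
    (hl : ∀ k, l k ≤ (∑ j, l j) / 2)
    (h : coeff φ * (coeff φ)ᴴ = Matrix.diagonal fun k => (l k : ℂ)) :
    ∃ Λ : Matrix (a × b) (a × b) ℂ → Matrix (Fin 2 × Fin 2) (Fin 2 × Fin 2) ℂ,
      IsLOCC Λ ∧ Λ (ketbra φ) = ((∑ k, l k : ℝ) : ℂ) • bellState := by
  obtain ⟨κ, _, w, p, q, hw, hpq, hsum⟩ := exists_pairing l h0 hl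
  -- This forces `w i = 0` when `l` vanishes at `p i` or `q i`, so the divisions by zero in `c` are
  -- harmless.
  have hwl : ∀ i, w i ≤ l (p i) ∧ w i ≤ l (q i) := fun i => by
    have : ∀ k, w i * ((if p i = k then 1 else 0) + (if q i = k then 1 else 0)) ≤ l k := fun k => by
      rw [hsum k]
      exact Finset.single_le_sum (f := fun i => w i * ((if p i = k then 1 else 0) +
        (if q i = k then 1 else 0))) (fun i _ => mul_nonneg (hw i) (by positivity))
        (Finset.mem_univ i)
    refine ⟨?_, ?_⟩
    · simpa [(hpq i).symm] using this (p i)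
    · simpa [hpq i] using this (q i)
  let c : κ → a → ℂ := fun i x => ((Real.sqrt (w i) / Real.sqrt (l x) : ℝ) : ℂ)
  have hc : ∀ i x, star (c i x) = c i x := fun i x => Complex.conj_ofReal _
  have hcc : ∀ i x, c i x * c i x = ((w i / l x : ℝ) : ℂ) := fun i x => by
    rw [← Complex.ofReal_mul, div_mul_div_comm, Real.mul_self_sqrt (hw i),
      Real.mul_self_sqrt (h0 x)]
  have hcl : ∀ i x, w i ≤ l x → c i x * l x * c i x = (w i : ℂ) := fun i x hx => by
    rw [mul_right_comm, hcc, ← Complex.ofReal_mul]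
    congr 1
    rcases (h0 x).eq_or_lt with h2 | h2
    · have : w i = 0 := le_antisymm (hx.trans h2.symm.le) (hw i)
      simp [this]
    · field_simp
  -- Outcome `inl i` filters the levels `p i` and `q i` onto a qubit, rescaled so that both get
  -- weight `w i`. The outcomes `inr j` cover the levels with `l j = 0` and have probability zero.
  let E : κ ⊕ a → Matrix (Fin 2) a ℂ := Sum.elim
    (fun i => Matrix.of ![Pi.single (p i) (c i (p i)), Pi.single (q i) (c i (q i))])
    (fun j => if l j = 0 then Matrix.single 0 j 1 else 0)
  have hE : ∑ i, (E i)ᴴ * E i = 1 := by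
    have hA : ∀ i, (E (.inl i))ᴴ * E (.inl i) = Matrix.diagonal fun k =>
        ((w i * ((if p i = k then 1 else 0) + (if q i = k then 1 else 0)) / l k : ℝ) : ℂ) := by
      intro i
      have h1 : ∀ x k k',
          star ((Pi.single x (c i x) : a → ℂ) k) * (Pi.single x (c i x) : a → ℂ) k' =
          if k = k' then ((w i * (if x = k then 1 else 0) / l k : ℝ) : ℂ) else 0 := by
        intro x k k'
        by_cases h1 : k = x
        · subst h1
          by_cases h2 : k = k'
          · subst h2
            simp only [Pi.single_eq_same, hc, hcc, if_true, mul_one]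
          · simp [h2, Ne.symm h2]
        · simp [h1, Ne.symm h1]
      ext k k'
      rw [Matrix.mul_apply, Fin.sum_univ_two, Matrix.diagonal_apply]
      refine (congrArg₂ (· + ·) (h1 (p i) k k') (h1 (q i) k k')).trans ?_
      split_ifs <;> simp [mul_add, add_div]
    have hB : ∀ j, (E (.inr j))ᴴ * E (.inr j) =
        Matrix.diagonal fun k => if k = j ∧ l j = 0 then 1 else 0 := by
      intro j
      by_cases hj : l j = 0
      · simp only [E, Sum.elim_inr, hj, if_true, Matrix.conjTranspose_single, star_one,
          Matrix.single_mul_single_same, mul_one, and_true]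
        ext x y
        simp only [Matrix.single_apply, Matrix.diagonal_apply]
        grind
      · simp [E, hj]
    rw [Fintype.sum_sum_type]
    simp only [hA, hB]
    ext k k'
    rw [Matrix.add_apply, Matrix.sum_apply, Matrix.sum_apply]
    by_cases hk : k = k'
    · subst hk
      simp only [Matrix.diagonal_apply_eq, Matrix.one_apply_eq]
      rw [← Complex.ofReal_sum, ← Finset.sum_div, ← hsum k]
      by_cases hlk : l k = 0
      · simp [hlk, ite_and]
      · rw [Finset.sum_eq_zero fun j _ => if_neg (by rintro ⟨rfl, h⟩; exact hlk h)]
        simp [div_self hlk]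
    · simp [Matrix.diagonal_apply_ne _ hk, Matrix.one_apply_ne hk]
  let ψ := fun i => (E i ⊗ₖ (1 : Matrix b b ℂ)) *ᵥ φ
  have hψ : ∀ i, coeff (ψ i) * (coeff (ψ i))ᴴ =
      ((Sum.elim w 0 i : ℝ) : ℂ) • (1 : Matrix (Fin 2) (Fin 2) ℂ) := by
    intro i
    rw [coeff_kronecker_one_mulVec, Matrix.conjTranspose_mul, Matrix.mul_assoc,
      ← Matrix.mul_assoc (coeff φ), h]
    rcases i with i | j
    · have h1 : ∀ x y, ∑ k, (Pi.single x (c i x) : a → ℂ) k * (l k : ℂ) *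
          star ((Pi.single y (c i y) : a → ℂ) k) = if x = y then c i x * l x * c i y else 0 := by
        intro x y
        rw [Finset.sum_eq_single x (fun k _ hk => by simp [hk]) (by simp)]
        by_cases hxy : x = y
        · subst hxy; rw [if_pos rfl, Pi.single_eq_same, hc]
        · simp [hxy]
      ext x y
      rw [← Matrix.mul_assoc, Matrix.mul_apply]
      simp only [Matrix.mul_diagonal]
      fin_cases x <;> fin_cases y
      · refine (h1 (p i) (p i)).trans ?_
        simpa using hcl _ _ (hwl i).1
      · refine (h1 (p i) (q i)).trans ?_
        simp [hpq i]
      · refine (h1 (q i) (p i)).trans ?_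
        simp [(hpq i).symm]
      · refine (h1 (q i) (q i)).trans ?_
        simpa using hcl _ _ (hwl i).2
    · by_cases hj : l j = 0
      · ext x y
        rw [Matrix.mul_apply]
        simp only [Matrix.diagonal_mul]
        simp [E, hj, Matrix.single_apply, ite_and]
      · simp [E, hj]
  choose Φ hΦ hΦψ using fun i => exists_isLOCC_of_coeff_mul_conjTranspose (ψ i)
    (r := Sum.elim w 0 i) (by cases i <;> simp [hw]) (hψ i)
  refine ⟨_, IsLOCC.alice_fintype E hE Φ hΦ, ?_⟩
  simp only [conj_ketbra]
  refine (Finset.sum_congr rfl fun i _ => hΦψ i).trans ?_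
  rw [← Finset.sum_smul]
  congr 1
  rw [← Complex.ofReal_sum]
  congr 1
  simp_rw [hsum]
  rw [Finset.sum_comm]
  simp [Fintype.sum_sum_type, ← Finset.mul_sum, Finset.sum_add_distrib]
  simp [one_add_one_eq_two, mul_comm, ← Finset.sum_mul]

/-! ### Schmidt coefficients and general pure states -/

/-- The largest squared Schmidt coefficient is the squared operator norm of the coefficient
matrix. -/
theorem maxSchmidtSq_eq {a b : Type} [Fintype a] [DecidableEq a] [Fintype b] [DecidableEq b]
    (φ : a × b → ℂ) : maxSchmidtSq φ = ‖coeff φ‖ ^ 2 := by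
  have hA := Matrix.isHermitian_mul_conjTranspose_self (coeff φ)
  have h1 : ‖coeff φ‖ ^ 2 = ‖coeff φ * (coeff φ)ᴴ‖ := by
    rw [sq, ← Matrix.l2_opNorm_conjTranspose (coeff φ), ← Matrix.l2_opNorm_conjTranspose_mul_self,
      Matrix.conjTranspose_conjTranspose]
  have h2 : ‖coeff φ * (coeff φ)ᴴ‖ = ‖fun i => (hA.eigenvalues i : ℂ)‖ := by
    rw [← Matrix.l2_opNorm_diagonal]
    conv_lhs => rw [hA.spectral_theorem, Unitary.conjStarAlgAut_apply]
    rw [← Unitary.coe_star, CStarRing.norm_mul_coe_unitary, CStarRing.norm_coe_unitary_mul]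
    rfl
  have h0 : ∀ i, 0 ≤ hA.eigenvalues i := fun i =>
    (Matrix.posSemidef_self_mul_conjTranspose (coeff φ)).eigenvalues_nonneg i
  have h3 : ∀ i, ‖(hA.eigenvalues i : ℂ)‖ = hA.eigenvalues i := fun i => by
    rw [Complex.norm_real, Real.norm_of_nonneg (h0 i)]
  rw [h1, h2]
  change ⨆ i, hA.eigenvalues i = _
  refine le_antisymm (Real.iSup_le (fun i => ?_) (norm_nonneg _)) ?_
  · rw [← h3 i]
    exact norm_le_pi_norm (fun i => (hA.eigenvalues i : ℂ)) i
  · refine (pi_norm_le_iff_of_nonneg (Real.iSup_nonneg h0)).2 fun i => ?_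
    rw [h3]
    exact le_ciSup (Set.finite_range _).bddAbove i

/-- A pure state whose largest squared Schmidt coefficient is at most one half of the squared norm
can be turned into a Bell pair by LOCC. -/
theorem exists_isLOCC_bellState {a b : Type} [Fintype a] [DecidableEq a] [Fintype b]
    [DecidableEq b] (φ : a × b → ℂ) (h : maxSchmidtSq φ ≤ normSq φ / 2) :
    ∃ Λ : Matrix (a × b) (a × b) ℂ → Matrix (Fin 2 × Fin 2) (Fin 2 × Fin 2) ℂ,
      IsLOCC Λ ∧ Λ (ketbra φ) = ((normSq φ : ℝ) : ℂ) • bellState := by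
  have hA := Matrix.isHermitian_mul_conjTranspose_self (coeff φ)
  let U : Matrix a a ℂ := hA.eigenvectorUnitary
  have hU : (star U)ᴴ * star U = 1 := by
    rw [← Matrix.star_eq_conjTranspose, star_star]
    exact Unitary.coe_mul_star_self _
  have hsum : ∑ k, hA.eigenvalues k = normSq φ := by
    have := hA.trace_eq_sum_eigenvalues
    rw [← normSq_eq_trace_coeff] at this
    exact Complex.ofReal_injective (by rw [this, Complex.ofReal_sum]; rfl)
  -- Alice first rotates to an eigenbasis of her reduced operator, as a measurement with one
  -- outcome.
  let ψ := (star U ⊗ₖ (1 : Matrix b b ℂ)) *ᵥ φ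
  have hψ : coeff ψ * (coeff ψ)ᴴ = Matrix.diagonal fun k => (hA.eigenvalues k : ℂ) := by
    have := hA.conjStarAlgAut_star_eigenvectorUnitary
    rw [Unitary.conjStarAlgAut_star_apply] at this
    rw [coeff_kronecker_one_mulVec, Matrix.conjTranspose_mul, ← Matrix.star_eq_conjTranspose,
      star_star, Matrix.mul_assoc, ← Matrix.mul_assoc (coeff φ), ← Matrix.mul_assoc]
    exact this
  obtain ⟨Λ, hΛ, hΛψ⟩ := exists_isLOCC_of_diagonal ψ hA.eigenvalues
    (fun i => (Matrix.posSemidef_self_mul_conjTranspose (coeff φ)).eigenvalues_nonneg i)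
    (fun k => by
      rw [hsum]
      exact (le_ciSup (f := hA.eigenvalues) (Set.finite_range _).bddAbove k).trans h) hψ
  refine ⟨_, IsLOCC.alice_fintype (ι := Unit) (fun _ => star U) (by simpa using hU) (fun _ => Λ)
    fun _ => hΛ, ?_⟩
  simp only [conj_ketbra, Finset.univ_unique, Finset.sum_singleton]
  rw [← hsum]
  exact hΛψ

/-! ### Passing from approximate to exact measurements -/

/-- The operators `|v x⟩⟨v x|` (up to conjugation) sum to the identity. -/
def IsResolution {ι K : Type} [Fintype ι] [DecidableEq K] (v : ι → K → ℂ) : Prop :=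
  ∀ i j, ∑ x, star (v x i) * v x j = if i = j then 1 else 0

/-- If a resolution of the identity into vectors satisfies a continuous quadratic constraint up to
every positive error, then some resolution of the identity satisfies it exactly. -/
theorem exists_isResolution_le_zero {K : Type} [Fintype K] [DecidableEq K] [Nonempty K]
    (g h : (K → ℂ) → ℝ) (hg : Continuous g) (hh : Continuous h)
    (hg2 : ∀ (c : ℝ) v, g ((c : ℂ) • v) = c ^ 2 * g v)
    (hh2 : ∀ (c : ℝ) v, h ((c : ℂ) • v) = c ^ 2 * h v)
    (H : ∀ ε > 0, ∃ (ι : Type) (_ : Fintype ι) (v : ι → K → ℂ), IsResolution v ∧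
      ∀ x, g (v x) ≤ ε * h (v x)) :
    ∃ (ι : Type) (_ : Fintype ι) (v : ι → K → ℂ), IsResolution v ∧ ∀ x, g (v x) ≤ 0 := by
  let P : (K → ℂ) → K → K → ℂ := fun v i j => star (v i) * v j
  have hP : Continuous P := by fun_prop
  have hP2 : ∀ (c : ℝ) v, P ((c : ℂ) • v) = (c ^ 2) • P v := fun c v => by
    funext i j
    simp [P]
    ring
  have hN : Continuous (normSq : (K → ℂ) → ℝ) := by unfold normSq; fun_prop
  have hsphere : IsCompact {v : K → ℂ | normSq v = 1} := by
    refine Metric.isCompact_of_isClosed_isBounded (isClosed_eq hN continuous_const) ?_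
    refine (Metric.isBounded_closedBall (x := 0) (r := 1)).subset fun v hv => ?_
    rw [mem_closedBall_zero_iff, pi_norm_le_iff_of_nonneg zero_le_one]
    intro i
    have : ‖v i‖ ^ 2 ≤ 1 := by
      rw [← show normSq v = 1 from hv]
      exact Finset.single_le_sum (f := fun i => ‖v i‖ ^ 2) (fun _ _ => by positivity)
        (Finset.mem_univ i)
    nlinarith [norm_nonneg (v i)]
  set d : ℝ := (Fintype.card K : ℝ) with hd
  have hdpos : 0 < d := by simp [hd, Fintype.card_pos]
  let I : K → K → ℂ := fun i j => if i = j then 1 else 0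
  have hres : ∀ {ι : Type} [Fintype ι] {v : ι → K → ℂ}, IsResolution v ↔ ∑ x, P (v x) = I := by
    intro ι _ v
    simp only [IsResolution, funext_iff, Finset.sum_apply, P, I]
  set S : Set (K → K → ℂ) := P '' {v | normSq v = 1 ∧ g v ≤ 0} with hS
  have hScomp : IsCompact S :=
    (hsphere.inter_right (isClosed_le hg continuous_const)).image hP
  have hmem : d⁻¹ • I ∈ convexHull ℝ S := by
    by_contra hx
    obtain ⟨f, u, hf, hfx⟩ := geometric_hahn_banach_closed_point (convex_convexHull ℝ _)
      (isCompact_convexHull_of_finiteDimensional hScomp).isClosed hx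
    -- Unit vectors on the wrong side of the separating hyperplane; the goal is one among them with
    -- `g ≤ 0`.
    have hT : IsCompact ({v : K → ℂ | normSq v = 1} ∩ {v | u ≤ f (P v)}) :=
      hsphere.inter_right (isClosed_le continuous_const (f.continuous.comp hP))
    obtain ⟨B, hB⟩ := (hsphere.image hh).bddAbove
    have hex : ∀ ε > 0, ∃ v ∈ {v : K → ℂ | normSq v = 1} ∩ {v | u ≤ f (P v)}, g v ≤ ε * B := by
      intro ε hε
      obtain ⟨ι, _, v, hv, hgv⟩ := H ε hε
      have hsumN : ∑ x, normSq (v x) = d := by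
        have h1 : ((∑ x, normSq (v x) : ℝ) : ℂ) = (d : ℝ) := by
          simp only [Complex.ofReal_sum, ofReal_normSq, dotProduct, Pi.star_apply]
          rw [Finset.sum_comm]
          rw [Finset.sum_congr rfl fun i _ => hv i i]
          simp [hd]
        exact_mod_cast h1
      -- The resolution averages to the identity, where `f` exceeds `u`, so some vector of it lies
      -- beyond the hyperplane.
      have hlt : ∑ x, u * normSq (v x) < ∑ x, f (P (v x)) := by
        rw [← Finset.mul_sum, hsumN, ← map_sum, hres.1 hv]
        rw [map_smul, smul_eq_mul, inv_mul_eq_div, lt_div_iff₀ hdpos] at hfx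
        exact hfx
      obtain ⟨x, -, hx⟩ := Finset.exists_lt_of_sum_lt hlt
      have hpos : 0 < normSq (v x) := by
        refine (normSq_nonneg _).lt_of_ne fun h0 => ?_
        have h1 : P 0 = 0 := by funext i j; simp [P]
        rw [← h0, normSq_eq_zero h0.symm, h1] at hx
        simp at hx
      have hc : ((Real.sqrt (normSq (v x)))⁻¹) ^ 2 = (normSq (v x))⁻¹ := by
        rw [inv_pow, Real.sq_sqrt hpos.le]
      have hone : normSq ((((Real.sqrt (normSq (v x)))⁻¹ : ℝ) : ℂ) • v x) = 1 := by
        rw [normSq_smul, Complex.norm_real, Real.norm_eq_abs, sq_abs, hc,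
          inv_mul_cancel₀ hpos.ne']
      refine ⟨_, ⟨hone, ?_⟩, ?_⟩
      · rw [Set.mem_ofPred, hP2, map_smul, hc, smul_eq_mul, inv_mul_eq_div, le_div_iff₀ hpos]
        exact hx.le
      · refine le_trans ?_ (mul_le_mul_of_nonneg_left (hB ⟨_, hone, rfl⟩) hε.le)
        rw [hg2, hh2, mul_left_comm]
        exact mul_le_mul_of_nonneg_left (hgv x) (by positivity)
    obtain ⟨v₁, hv₁, -⟩ := hex 1 one_pos
    -- The minimum of `g` on this compact set is at most `ε * B` for every `ε > 0`, hence
    -- nonpositive.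
    obtain ⟨v₀, hv₀, hmin⟩ := hT.exists_isMinOn ⟨v₁, hv₁⟩ hg.continuousOn
    have hle : g v₀ ≤ 0 := by
      by_contra! hlt
      obtain ⟨v, hv, hgv⟩ := hex (g v₀ / (2 * (|B| + 1))) (by positivity)
      have h1 : g v₀ ≤ g v := hmin hv
      have h2 : g v₀ / (2 * (|B| + 1)) * B ≤ g v₀ / 2 := by
        rw [div_mul_eq_mul_div, div_le_div_iff₀ (by positivity) two_pos]
        nlinarith [le_abs_self B, abs_nonneg B]
      linarith
    exact absurd (hf _ (subset_convexHull ℝ _ ⟨v₀, ⟨hv₀.1, hle⟩, rfl⟩)) (not_lt.2 hv₀.2)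
  obtain ⟨ι, _, w, z, hw, -, hz, hx⟩ := mem_convexHull_iff_exists_fintype.1 hmem
  choose v hv hvz using hz
  refine ⟨ι, inferInstance, fun i => ((Real.sqrt (d * w i) : ℝ) : ℂ) • v i, hres.2 ?_, fun i => ?_⟩
  · have h1 : ∀ i, P (((Real.sqrt (d * w i) : ℝ) : ℂ) • v i) = d • w i • z i := fun i => by
      rw [hP2, Real.sq_sqrt (mul_nonneg hdpos.le (hw i)), hvz, mul_smul]
    rw [Finset.sum_congr rfl fun i _ => h1 i, ← Finset.smul_sum, hx, smul_inv_smul₀ hdpos.ne']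
  · rw [hg2]
    exact mul_nonpos_of_nonneg_of_nonpos (by positivity) (hv i).2

/-- If a sum of positive rank-one operators has rank one, then the vectors are collinear. -/
theorem exists_eq_smul_of_sum_ketbra {κ s : Type} [Fintype κ] [Fintype s] {φ : κ → s → ℂ}
    {ψ : s → ℂ} {r : ℂ} (h : ∑ k, ketbra (φ k) = r • ketbra ψ) (k : κ) :
    ∃ z : ℂ, φ k = z • ψ := by
  have hq : ∀ χ y : s → ℂ, star y ⬝ᵥ (ketbra χ *ᵥ y) = ((‖star y ⬝ᵥ χ‖ ^ 2 : ℝ) : ℂ) := by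
    intro χ y
    rw [ketbra, Matrix.vecMulVec_mulVec, Complex.ofReal_pow, ← Complex.mul_conj',
      starRingEnd_apply, ← Matrix.star_dotProduct_star]
    rw [star_star, dotProduct_comm (star χ) y, dotProduct_smul, op_smul_eq_mul]
  -- Orthogonal projection onto `ψ`. The quadratic form of `h` at the remainder `y` is zero on the
  -- right, so `y` is orthogonal to every `φ j`, thus to itself.
  refine ⟨star ψ ⬝ᵥ φ k / (normSq ψ : ℝ), ?_⟩
  set z := star ψ ⬝ᵥ φ k / (normSq ψ : ℝ) with hz
  set y := φ k - z • ψ with hy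
  have h1 : star ψ ⬝ᵥ y = 0 := by
    rw [hy, dotProduct_sub, dotProduct_smul, ← ofReal_normSq, smul_eq_mul, hz]
    by_cases h0 : normSq ψ = 0
    · simp [normSq_eq_zero h0]
    · rw [div_mul_cancel₀ _ (by exact_mod_cast h0), sub_self]
  have h2 : star y ⬝ᵥ ψ = 0 := by
    rw [← star_eq_zero, ← h1, Matrix.star_dotProduct, star_star, dotProduct_comm]
  have h3 : ∑ j, ‖star y ⬝ᵥ φ j‖ ^ 2 = 0 := by
    have := congrArg (fun X => star y ⬝ᵥ (X *ᵥ y)) h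
    simp only [Matrix.sum_mulVec, dotProduct_sum, hq, Matrix.smul_mulVec, dotProduct_smul,
      h2] at this
    rw [← Complex.ofReal_sum] at this
    exact Complex.ofReal_injective (this.trans (by simp))
  have h4 : star y ⬝ᵥ φ k = 0 := by
    have := (Finset.sum_eq_zero_iff_of_nonneg fun _ _ => by positivity).1 h3 k (Finset.mem_univ k)
    simpa using this
  have h5 : normSq y = 0 := by
    have : ((normSq y : ℝ) : ℂ) = 0 := by
      rw [ofReal_normSq]
      conv_lhs => rw [hy]
      rw [← hy, dotProduct_sub, dotProduct_smul, h2, h4]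
      simp
    exact_mod_cast this
  exact sub_eq_zero.1 (normSq_eq_zero h5)

theorem trace_ketbra {s : Type} [Fintype s] (φ : s → ℂ) :
    (ketbra φ).trace = ((normSq φ : ℝ) : ℂ) := by
  rw [ofReal_normSq, ketbra, Matrix.trace_vecMulVec, dotProduct_comm]

theorem norm_coeff_smul_sq {a b : Type} [Fintype a] [DecidableEq a] [Fintype b] [DecidableEq b]
    (c : ℂ) (φ : a × b → ℂ) : ‖coeff (c • φ)‖ ^ 2 = ‖c‖ ^ 2 * ‖coeff φ‖ ^ 2 := by
  rw [show coeff (c • φ) = c • coeff φ from rfl, norm_smul, mul_pow]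

/-! ### Branches of the Bank's measurement -/

section Branches

variable {A' B' K : Type} [Fintype K] (θ : ℝ) (Ω : EuclideanSpace ℂ (A' × B' × K))

/-- The unnormalized state of `AA'BB'` after projecting `K` onto a vector with conjugate `v`. -/
def slice (v : K → ℂ) : (Fin 2 × A') × (Fin 2 × B') → ℂ :=
  fun x => ∑ k, v k * jointState θ Ω (x, k)

theorem slice_zero : slice θ Ω 0 = 0 := by
  funext x; simp [slice]

theorem slice_smul (c : ℂ) (v : K → ℂ) : slice θ Ω (c • v) = c • slice θ Ω v := by
  funext x; simp [slice, Finset.mul_sum, mul_assoc]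

variable [Fintype A'] [DecidableEq A'] [Fintype B'] [DecidableEq B']

theorem branch_apply (M : Matrix K K ℂ) (x : (Fin 2 × A') × (Fin 2 × B')) (k : K) :
    branch θ Ω M (x, k) = slice θ Ω (M k) x := by
  simp only [branch, slice, Matrix.mulVec, dotProduct, Matrix.kroneckerMap_apply,
    Fintype.sum_prod_type (α₂ := K), Matrix.one_apply]
  rw [Finset.sum_eq_single x (fun y _ hy => by simp [hy.symm]) (by simp)]
  simp

theorem branchProb_eq (M : Matrix K K ℂ) :
    branchProb θ Ω M = ∑ k, normSq (slice θ Ω (M k)) := by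
  simp only [branchProb, normSq, Fintype.sum_prod_type_right (α₂ := K), branch_apply]

theorem condState_eq (M : Matrix K K ℂ) :
    condState θ Ω M = ((branchProb θ Ω M)⁻¹ : ℂ) • ∑ k, ketbra (slice θ Ω (M k)) := by
  rw [condState]
  congr 1
  ext x y
  simp [Matrix.sum_apply, branch_apply, ketbra, Matrix.vecMulVec_apply]

/-- In a measurement with pure branches, the bound on the Schmidt coefficients of the branches
holds for each row of the operators. -/
theorem norm_coeff_slice_sq_le {n : ℕ} {M : Fin n → Matrix K K ℂ}
    {Ψ : Fin n → (Fin 2 × A') × (Fin 2 × B') → ℂ} (hΨ : IsPureBranches θ Ω M Ψ) {t : ℝ}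
    {m : Fin n} (ht : branchProb θ Ω (M m) ≠ 0 → maxSchmidtSq (Ψ m) ≤ t) (k : K) :
    ‖coeff (slice θ Ω (M m k))‖ ^ 2 ≤ t * normSq (slice θ Ω (M m k)) := by
  by_cases hP : branchProb θ Ω (M m) = 0
  · rw [branchProb_eq, Finset.sum_eq_zero_iff_of_nonneg fun _ _ => normSq_nonneg _] at hP
    have h0 := hP k (Finset.mem_univ k)
    rw [h0, normSq_eq_zero h0, show coeff (0 : (Fin 2 × A') × (Fin 2 × B') → ℂ) = 0 from rfl]
    simp
  · have h1 := hΨ m hP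
    have hP' : (branchProb θ Ω (M m) : ℂ) ≠ 0 := by exact_mod_cast hP
    -- Conditional states have trace one, so `Ψ m` is automatically a unit vector.
    have h2 : normSq (Ψ m) = 1 := by
      have := congrArg Matrix.trace h1
      rw [condState_eq, Matrix.trace_smul, Matrix.trace_sum, trace_ketbra] at this
      simp only [trace_ketbra] at this
      rw [← Complex.ofReal_sum, ← branchProb_eq, smul_eq_mul, inv_mul_cancel₀ hP'] at this
      exact_mod_cast this.symm
    rw [condState_eq, inv_smul_eq_iff₀ hP'] at h1
    obtain ⟨z, hz⟩ := exists_eq_smul_of_sum_ketbra h1 k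
    rw [hz, norm_coeff_smul_sq, normSq_smul, h2, ← maxSchmidtSq_eq, mul_one, mul_comm]
    exact mul_le_mul_of_nonneg_right (ht hP) (by positivity)

variable [DecidableEq K]

/-- The operator on `K` whose only nonzero row is `v`, at position `k₀`. -/
def rowOp (k₀ : K) (v : K → ℂ) : Matrix K K ℂ := fun k => if k = k₀ then v else 0

theorem branchProb_rowOp (k₀ : K) (v : K → ℂ) :
    branchProb θ Ω (rowOp k₀ v) = normSq (slice θ Ω v) := by
  rw [branchProb_eq, Finset.sum_eq_single k₀ (fun k _ hk => by
    simp [rowOp, hk, slice_zero, normSq]) (by simp)]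
  simp [rowOp]

theorem condState_rowOp (k₀ : K) (v : K → ℂ) :
    condState θ Ω (rowOp k₀ v) =
      ((normSq (slice θ Ω v))⁻¹ : ℂ) • ketbra (slice θ Ω v) := by
  rw [condState_eq, branchProb_rowOp, Finset.sum_eq_single k₀ (fun k _ hk => by
    simp [rowOp, hk, slice_zero, ketbra]) (by simp)]
  simp [rowOp]

theorem isMeasurement_rowOp {n : ℕ} {ι : Type} [Fintype ι] (e : Fin n ≃ ι) (k₀ : K)
    {v : ι → K → ℂ} (hv : IsResolution v) : IsMeasurement fun j => rowOp k₀ (v (e j)) := by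
  ext i j
  have h : ∀ x, ((rowOp k₀ (v x))ᴴ * rowOp k₀ (v x)) i j = star (v x i) * v x j := by
    intro x
    rw [Matrix.mul_apply, Finset.sum_eq_single k₀ (fun k _ hk => by simp [rowOp, hk]) (by simp)]
    simp [rowOp]
  rw [Matrix.sum_apply, Matrix.one_apply, ← hv i j,
    ← Equiv.sum_comp e fun x => star (v x i) * v x j]
  exact Finset.sum_congr rfl fun x _ => h _

/-- Each `M†M` is the sum of the rank-one contributions of its rows, so treating every row as an
outcome refines the measurement. -/
theorem isResolution_rows {n : ℕ} {M : Fin n → Matrix K K ℂ} (hM : IsMeasurement M) :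
    IsResolution fun p : Fin n × K => M p.1 p.2 := by
  intro i j
  have := congrFun (congrFun hM i) j
  rw [Matrix.sum_apply, Matrix.one_apply] at this
  rw [← this, Fintype.sum_prod_type]
  rfl

/-- Measuring the Bank's register completely after `M` leaves a pure state in each branch. -/
theorem exists_isPureBranches [Nonempty K] {n : ℕ} {M : Fin n → Matrix K K ℂ}
    (hM : IsMeasurement M) :
    ∃ (N : ℕ) (M' : Fin N → Matrix K K ℂ) (Ψ : Fin N → (Fin 2 × A') × (Fin 2 × B') → ℂ),
      IsMeasurement M' ∧ IsPureBranches θ Ω M' Ψ ∧ ∀ j, ∃ m k,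
        branchProb θ Ω (M' j) = normSq (slice θ Ω (M m k)) ∧
        maxSchmidtSq (Ψ j) =
          (normSq (slice θ Ω (M m k)))⁻¹ * ‖coeff (slice θ Ω (M m k))‖ ^ 2 := by
  -- The final state of `K` is discarded, so any basis vector serves as the common output.
  let k₀ : K := Classical.arbitrary K
  obtain ⟨e⟩ : Nonempty (Fin (Fintype.card (Fin n × K)) ≃ Fin n × K) :=
    ⟨(Fintype.equivFin (Fin n × K)).symm⟩
  have hres := isMeasurement_rowOp e k₀ (isResolution_rows hM)
  have hc : ∀ v : K → ℂ, ‖(((Real.sqrt (normSq (slice θ Ω v)))⁻¹ : ℝ) : ℂ)‖ ^ 2 =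
      (normSq (slice θ Ω v))⁻¹ := fun v => by
    rw [Complex.norm_real, Real.norm_eq_abs, sq_abs, inv_pow, Real.sq_sqrt (normSq_nonneg _)]
  let Ψ : (K → ℂ) → (Fin 2 × A') × (Fin 2 × B') → ℂ := fun v =>
    (((Real.sqrt (normSq (slice θ Ω v)))⁻¹ : ℝ) : ℂ) • slice θ Ω v
  have hcond : ∀ v, condState θ Ω (rowOp k₀ v) = ketbra (Ψ v) := fun v => by
    rw [condState_rowOp, ketbra_smul, hc, Complex.ofReal_inv]
  have hmax : ∀ v, maxSchmidtSq (Ψ v) =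
      (normSq (slice θ Ω v))⁻¹ * ‖coeff (slice θ Ω v)‖ ^ 2 := fun v => by
    rw [maxSchmidtSq_eq, norm_coeff_smul_sq, hc]
  exact ⟨_, fun j => rowOp k₀ (M (e j).1 (e j).2), fun j => Ψ (M (e j).1 (e j).2),
    hres, fun j _ => hcond _, fun j =>
      ⟨(e j).1, (e j).2, branchProb_rowOp θ Ω _ _, hmax _⟩⟩

/-! ### The two implications -/

theorem maxSchmidtSq_nonneg {a b : Type} [Fintype a] [DecidableEq a] [Fintype b] [DecidableEq b]
    (φ : a × b → ℂ) : 0 ≤ maxSchmidtSq φ := by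
  rw [maxSchmidtSq_eq]; positivity

theorem muStar_le_of_feasible [Nonempty K] (h : BankMeasuresFeasible θ Ω) :
    muStar θ Ω ≤ 1 / 2 := by
  obtain ⟨n, M, hM, Λ, hΛ, hbell⟩ := h
  obtain ⟨N, M', Ψ, hM', hΨ, hval⟩ := exists_isPureBranches θ Ω hM
  unfold muStar
  refine le_trans (csInf_le (a := ⨆ m : {m : Fin N // branchProb θ Ω (M' m) ≠ 0},
    maxSchmidtSq (Ψ m)) ⟨0, ?_⟩ ⟨N, M', Ψ, hM', hΨ, rfl⟩) (Real.iSup_le (fun j => ?_) (by norm_num))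
  · rintro _ ⟨n, M, Ψ, -, -, rfl⟩
    exact Real.iSup_nonneg fun _ => maxSchmidtSq_nonneg _
  obtain ⟨j, hj⟩ := j
  obtain ⟨m, k, hp, hs⟩ := hval j
  rw [hp] at hj
  have hpos : 0 < normSq (slice θ Ω (M m k)) := (normSq_nonneg _).lt_of_ne hj.symm
  have hP : branchProb θ Ω (M m) ≠ 0 := by
    rw [branchProb_eq]
    exact (hpos.trans_le (Finset.single_le_sum (f := fun k => normSq (slice θ Ω (M m k)))
      (fun _ _ => normSq_nonneg _) (Finset.mem_univ k))).ne'
  have hL := hbell m hP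
  have hlin := (hΛ m).isLinearMap
  rw [condState_eq, hlin.map_smul, inv_smul_eq_iff₀ (by exact_mod_cast hP)] at hL
  have hL' : ∑ k, Λ m (ketbra (slice θ Ω (M m k))) = (branchProb θ Ω (M m) : ℂ) • bellState := by
    rw [← hL]
    exact (map_sum hlin.mk' _ _).symm
  -- The Bell pair has no defect, so positivity kills the defect of each row of `M m`.
  have hD := congrArg bellDefect hL'
  rw [bellDefect_smul_bellState, bellDefect_sum, Finset.sum_eq_zero_iff_of_nonneg fun i _ =>
      bellDefect_nonneg ((hΛ m).posSemidef (posSemidef_ketbra _))] at hD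
  have := (hΛ m).norm_coeff_sq_le _ (hD k (Finset.mem_univ k))
  rw [hs, inv_mul_eq_div, div_le_iff₀ hpos]
  linarith

theorem feasible_of_muStar_le [Nonempty K] (h : muStar θ Ω ≤ 1 / 2) :
    BankMeasuresFeasible θ Ω := by
  have hslice : Continuous (slice θ Ω) := by unfold slice; fun_prop
  have hN : Continuous fun v => normSq (slice θ Ω v) := by
    unfold normSq
    exact continuous_finsetSum _ fun x _ => (((continuous_apply x).comp hslice).norm).pow 2
  have hC : Continuous fun v => ‖coeff (slice θ Ω v)‖ ^ 2 := by
    refine Continuous.pow (Continuous.norm ?_) 2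
    exact continuous_matrix fun i j => (continuous_apply (i, j)).comp hslice
  obtain ⟨ι, _, v, hv, hle⟩ := exists_isResolution_le_zero
    (fun v => ‖coeff (slice θ Ω v)‖ ^ 2 - normSq (slice θ Ω v) / 2)
    (fun v => normSq (slice θ Ω v)) (hC.sub (hN.div_const 2)) hN
    (fun c v => by
      rw [slice_smul, norm_coeff_smul_sq, normSq_smul, Complex.norm_real, Real.norm_eq_abs, sq_abs]
      ring)
    (fun c v => by
      rw [slice_smul, normSq_smul, Complex.norm_real, Real.norm_eq_abs, sq_abs])
    (fun ε hε => by
      -- The complete readout of `K` shows that the infimum is over a nonempty set.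
      obtain ⟨N, M', Ψ', hM', hΨ', -⟩ := exists_isPureBranches θ Ω
        (M := fun _ : Fin 1 => (1 : Matrix K K ℂ)) (by simp [IsMeasurement])
      have h' : muStar θ Ω < 1 / 2 + ε := by linarith
      unfold muStar at h'
      obtain ⟨_, ⟨n, M, Ψ, hM, hΨ, rfl⟩, hlt⟩ := exists_lt_of_csInf_lt
        (by exact ⟨_, N, M', Ψ', hM', hΨ', rfl⟩) h'
      refine ⟨Fin n × K, inferInstance, _, isResolution_rows hM, fun p => ?_⟩
      have := norm_coeff_slice_sq_le θ Ω hΨ (t := 1 / 2 + ε) (m := p.1)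
        (fun hp => (le_ciSup (f := fun m : {m : Fin n // branchProb θ Ω (M m) ≠ 0} =>
          maxSchmidtSq (Ψ m)) (Set.finite_range _).bddAbove ⟨p.1, hp⟩).trans hlt.le) p.2
      linarith)
  let e := (Fintype.equivFin ι).symm
  choose Λ hΛ hbell using fun x => exists_isLOCC_bellState (slice θ Ω (v x)) (by
    rw [maxSchmidtSq_eq]; linarith [hle x])
  let k₀ : K := Classical.arbitrary K
  refine ⟨_, fun j => rowOp k₀ (v (e j)), isMeasurement_rowOp e k₀ hv, fun j => Λ (e j),
    fun j => hΛ _, fun j hj => ?_⟩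
  rw [branchProb_rowOp] at hj
  beta_reduce
  rw [condState_rowOp, (hΛ (e j)).isLinearMap.map_smul, hbell,
    inv_smul_smul₀ (by exact_mod_cast hj)]

end Branches

end BankAssist

end

theorem mainTheorem6 {A' B' K : Type} [Fintype A'] [DecidableEq A'] [Fintype B'] [DecidableEq B']
    [Fintype K] [DecidableEq K] (θ : ℝ) (Ω : EuclideanSpace ℂ (A' × B' × K)) (hΩ : ‖Ω‖ = 1) :
    BankAssist.BankMeasuresFeasible θ Ω ↔ BankAssist.muStar θ Ω ≤ 1 / 2 := by
  -- For empty `K` the vector `Ω` would be zero, against its unit norm.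
  have : Nonempty K := by
    by_contra hK
    rw [not_nonempty_iff] at hK
    have : Ω = 0 := Subsingleton.elim _ _
    simp [this] at hΩ
  exact ⟨BankAssist.muStar_le_of_feasible θ Ω, BankAssist.feasible_of_muStar_le θ Ω⟩
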